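/- **Setting.** Let $G$ be a compact, simple, connected and simply connected Lie group with Lie algebra $i\mathbf g$ (physicists' convention), $T\subset G$ a Cartan subgroup (maximal torus) with Lie algebra $i\mathbf t$, $N(T)$ its normalizer, and $\operatorname{tr}$ the invariant positive definite form on $\mathbf g$ for which long roots have length squared $2$. Let $\alpha_i$, $\lambda_i^\vee$ ($i=1,\dots,r$) be the simple roots and simple coweights, $\phi=\sum_i k_i\alpha_i$ the highest root, and $\mathcal A=\{\tau\in\mathbf t:\alpha_i(\tau)\ge 0,\ \phi(\tau)\le 1\}$ the Weyl alcove, with vertices $\tau_0=0$, $\tau_i=\lambda_i^\vee/k_i$. For $I\subset\{0,\dots,r\}$ let $G_I$ be the stabilizer, under the adjoint action, of the elements $e^{2\pi i\tau}$ with $\tau$ in the open simplex spanned by the $\tau_i$, $i\in I$; let $\widetilde G_I$ be its universal cover (homotopy classes of paths in $G_I$ starting at $1$), and for $\tau\in\mathbf t$ let $\mathrm e_I^{2\pi i\tau}\in\widetilde G_I$ be the class of the path $s\mapsto e^{2\pi is\tau}$, $0\le s\le 1$; $\widetilde T_I$ denotes the set of these classes. Let $\chi_i:\widetilde T_{\{i\}}\to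 U(1)$ and $\chi_{ij}:\widetilde G_{\{i,j\}}\to U(1)$ be the functions $$\chi_i(\mathrm e_{\{i\}}^{2\pi i\tau})=e^{2\pi i\operatorname{tr}\tau_i\tau},\qquad \chi_{ij}(\widetilde\gamma)=\exp\Big[\tfrac1i\int_{\widetilde\gamma}i\operatorname{tr}(\tau_j-\tau_i)(\gamma^{-1}d\gamma)\Big].$$ Let $Z$ be a subgroup of the center of $G$. It acts on $\mathcal A$ by affine transformations $\tau\mapsto z\tau$ satisfying, for $\tau\in\mathcal A$, $z\,e^{2\pi i\tau}=w_z^{-1}e^{2\pi i\,z\tau}w_z$ with $w_z\in N(T)$, and $i\mapsto zi$ denotes the permutation of indices with $z\tau_i=\tau_{zi}$; write $i_z=z^{-1}i$. Choose such $w_z$, put $c_{z,z'}=w_zw_{z'}w_{zz'}^{-1}$, choose $e_{z,z'}\in\mathbf t$ with $c_{z,z'}=e^{2\pi ie_{z,z'}}$, and set $$(\delta e)_{z,z',z''}=w_ze_{z',z''}w_z^{-1}-e_{zz',z''}+e_{z,z'z''}-e_{z,z'},\quad \widetilde c_{z,z'}=\mathrm e_I^{2\pi ie_{z,z'}},\quad(\delta\widetilde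 c)_{z,z',z''}=\mathrm e_I^{2\pi i(\delta e)_{z,z',z''}}$$ (with $I=\{i,j\}$ in the argument of $\chi_{ij}$ and $I=\{i\}$ in the argument of $\chi_i$). Fix $\mathsf k\in\mathbb Z$. A family $u^{ijk}_{z,z'}\in U(1)$ is said to satisfy the *full associativity condition* if for all $i,j,k,l\in\{0,\dots,r\}$ and all $z,z',z''\in Z$ $$u^{j_zk_zl_z}_{z',z''}\,(u^{ikl}_{zz',z''})^{-1}\,u^{ijl}_{z,z'z''}\,(u^{ijk}_{z,z'})^{-1}=\chi_{kl}(\widetilde c_{z,z'})^{\mathsf k}\,\chi_l((\delta\widetilde c)_{z,z',z''})^{\mathsf k}.\qquad(*)$$ A family $u_{z,z'}\in U(1)$ solves the *reduced cohomological equation* $\delta u=U$ if for all $z,z',z''\in Z$ $$u_{z',z''}\,u_{zz',z''}^{-1}\,u_{z,z'z''}\,u_{z,z'}^{-1}=U_{z,z',z''}:=\chi_{(zz'0)(zz'z''0)}(\widetilde c_{z,z'})^{\mathsf k}\,\chi_{zz'z''0}((\delta\widetilde c)_{z,z',z''})^{\mathsf k}.$$ **Lemma 3.** If $(u_{z,z'})$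 solves $\delta u=U$, then $u^{ijk}_{z,z'}=\chi_{k\,(zz'0)}(\widetilde c_{z,z'})^{-\mathsf k}\,u_{z,z'}$ satisfies the full associativity condition $(*)$. Conversely, if a family $(u^{ijk}_{z,z'})$ satisfies $(*)$, then $u_{z,z'}:=u^{0\,(z0)\,(zz'0)}_{z,z'}$ solves $\delta u=U$. Hence only the reduced cohomological equation needs to be solved. -/

import Mathlib

open scoped Manifold ContDiff

namespace WZW

/-! ### Exponential map and adjoint action of a Lie group -/

section Exponential

variable {d : ℕ} {G : Type*} [TopologicalSpace G] [ChartedSpace (EuclideanSpace ℝ (Fin d)) G]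
  [Group G]

instance instLieGroupMinSmoothness [LieGroup (𝓡 d) ∞ G] :
    LieGroup (𝓡 d) (minSmoothness ℝ 3) G :=
  LieGroup.of_le (n := ∞) (by simp only [minSmoothness_of_isRCLikeNormedField]; exact ENat.LEInfty.out)

theorem mulInvariantVectorField_apply_one (X : GroupLieAlgebra (𝓡 d) G) :
    mulInvariantVectorField X (1 : G) = X := by
  have e : (fun x : G ↦ 1 * x) = id := by ext; simp
  unfold mulInvariantVectorField
  rw [e, mfderiv_id]
  rfl

theorem mfderiv_one_of_eq_id (f : G → G) (hf : f = id) (v : EuclideanSpace ℝ (Fin d)) :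
    (mfderiv (𝓡 d) (𝓡 d) f 1 v : EuclideanSpace ℝ (Fin d)) = v := by
  subst hf
  rw [mfderiv_id]
  rfl

variable [LieGroup (𝓡 d) ∞ G]

theorem contMDiff_leftInvariant (X : GroupLieAlgebra (𝓡 d) G) :
    ContMDiff (𝓡 d) (𝓡 d).tangent 1
      (fun g : G ↦ (⟨g, mulInvariantVectorField X g⟩ : TangentBundle (𝓡 d) G)) :=
  (contMDiff_mulInvariantVectorField X).of_le (by simp)

theorem mul_left_mulInvariantVectorField (X : GroupLieAlgebra (𝓡 d) G) (g h : G) :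
    mfderiv (𝓡 d) (𝓡 d) (fun x : G ↦ g * x) h (mulInvariantVectorField X h) =
      mulInvariantVectorField X (g * h) := by
  have e : (fun x : G ↦ g * h * x) = (fun x ↦ g * x) ∘ (fun x ↦ h * x) := by
    ext x; simp [mul_assoc]
  have h1 : MDifferentiableAt (𝓡 d) (𝓡 d) (fun x : G ↦ h * x) 1 :=
    (contMDiff_mul_left (I := 𝓡 d) (n := ∞)).contMDiffAt.mdifferentiableAt (by simp)
  have h2 : MDifferentiableAt (𝓡 d) (𝓡 d) (fun x : G ↦ g * x) (h * 1) :=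
    (contMDiff_mul_left (I := 𝓡 d) (n := ∞)).contMDiffAt.mdifferentiableAt (by simp)
  unfold mulInvariantVectorField
  rw [e, mfderiv_comp (I' := 𝓡 d) _ h2 h1]
  have e1 : h * 1 = h := mul_one h
  change mfderiv (𝓡 d) (𝓡 d) (fun x : G ↦ g * x) h (mfderiv (𝓡 d) (𝓡 d) (fun x ↦ h * x) 1 X) =
    mfderiv (𝓡 d) (𝓡 d) (fun x : G ↦ g * x) (h * 1) (mfderiv (𝓡 d) (𝓡 d) (fun x ↦ h * x) 1 X)
  rw [e1]

theorem hasMFDerivAt_mul_left {X : GroupLieAlgebra (𝓡 d) G} {γ : ℝ → G} {s : Set ℝ} {t : ℝ}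
    (g : G)
    (h : HasMFDerivWithinAt 𝓘(ℝ, ℝ) (𝓡 d) γ s t
      ((1 : ℝ →L[ℝ] ℝ).smulRight (mulInvariantVectorField X (γ t)))) :
    HasMFDerivWithinAt 𝓘(ℝ, ℝ) (𝓡 d) (fun u ↦ g * γ u) s t
      ((1 : ℝ →L[ℝ] ℝ).smulRight (mulInvariantVectorField X (g * γ t))) := by
  have h2 : MDifferentiableAt (𝓡 d) (𝓡 d) (fun x : G ↦ g * x) (γ t) :=
    (contMDiff_mul_left (I := 𝓡 d) (n := ∞)).contMDiffAt.mdifferentiableAt (by simp)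
  refine (h2.hasMFDerivAt.comp_hasMFDerivWithinAt t h).congr_mfderiv
    (ContinuousLinearMap.ext fun (c : ℝ) ↦ ?_)
  change mfderiv (𝓡 d) (𝓡 d) (fun x : G ↦ g * x) (γ t)
    (c • mulInvariantVectorField X (γ t)) = c • mulInvariantVectorField X (g * γ t)
  rw [map_smul, mul_left_mulInvariantVectorField]

variable [T2Space G]

theorem exists_integralCurve (X : GroupLieAlgebra (𝓡 d) G) :
    ∃ γ : ℝ → G, γ 0 = 1 ∧ IsMIntegralCurve γ (mulInvariantVectorField (I := 𝓡 d) X) := by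
  obtain ⟨γ, h0, hγ⟩ := exists_isMIntegralCurveAt_of_contMDiffAt_boundaryless (t₀ := 0)
    (contMDiff_leftInvariant X).contMDiffAt (x₀ := (1 : G))
  obtain ⟨ε, hε, hball⟩ := (isMIntegralCurveAt_iff'.mp hγ)
  rw [Real.ball_eq_Ioo, zero_sub, zero_add] at hball
  refine exists_isMIntegralCurve_of_isMIntegralCurveOn (contMDiff_leftInvariant X) hε
    (fun x ↦ ⟨fun t ↦ x * γ t, by simp [h0], fun t ht ↦ ?_⟩) 1
  exact hasMFDerivAt_mul_left x (hball t ht)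

/-- The one-parameter subgroup with velocity `X`: the integral curve through `1` of the left-invariant
vector field generated by `X`. -/
noncomputable def oneParam (X : GroupLieAlgebra (𝓡 d) G) : ℝ → G :=
  (exists_integralCurve X).choose

theorem oneParam_zero (X : GroupLieAlgebra (𝓡 d) G) : oneParam X 0 = 1 :=
  (exists_integralCurve X).choose_spec.1

theorem oneParam_isMIntegralCurve (X : GroupLieAlgebra (𝓡 d) G) :
    IsMIntegralCurve (oneParam X) (mulInvariantVectorField (I := 𝓡 d) X) :=
  (exists_integralCurve X).choose_spec.2

theorem eq_mul_oneParam {X : GroupLieAlgebra (𝓡 d) G} {γ : ℝ → G}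
    (h : IsMIntegralCurve γ (mulInvariantVectorField (I := 𝓡 d) X)) (t : ℝ) :
    γ t = γ 0 * oneParam X t := by
  have h2 : IsMIntegralCurve (fun t ↦ γ 0 * oneParam X t)
      (mulInvariantVectorField (I := 𝓡 d) X) := fun t ↦ by
    have := hasMFDerivAt_mul_left (s := Set.univ) (γ 0)
      (oneParam_isMIntegralCurve X t).hasMFDerivWithinAt
    exact hasMFDerivWithinAt_univ.mp this
  exact congrFun (isMIntegralCurve_Ioo_eq_of_contMDiff_boundaryless (t₀ := 0)
    (contMDiff_leftInvariant X) h h2 (by simp [oneParam_zero])) t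

theorem oneParam_add (X : GroupLieAlgebra (𝓡 d) G) (s t : ℝ) :
    oneParam X (s + t) = oneParam X s * oneParam X t := by
  have := eq_mul_oneParam ((oneParam_isMIntegralCurve X).comp_add s) t
  simpa [add_comm] using this

theorem oneParam_smul (X : GroupLieAlgebra (𝓡 d) G) (c t : ℝ) :
    oneParam (c • X) t = oneParam X (c * t) := by
  have h := (oneParam_isMIntegralCurve X).comp_mul c
  have e : c • mulInvariantVectorField (I := 𝓡 d) X = mulInvariantVectorField (c • X) := by
    ext g
    exact (map_smul (mfderiv (𝓡 d) (𝓡 d) (fun x : G ↦ g * x) 1) c X).symm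
  rw [e] at h
  have := eq_mul_oneParam h t
  simpa [oneParam_zero, mul_comm] using this.symm

/-- A differentiable one-parameter subgroup is determined by its velocity at `0`. -/
theorem eq_oneParam {X : GroupLieAlgebra (𝓡 d) G} {f : ℝ → G}
    (hadd : ∀ s t, f (s + t) = f s * f t) (h1 : f 0 = 1)
    (h : HasMFDerivAt 𝓘(ℝ, ℝ) (𝓡 d) f 0
      ((1 : ℝ →L[ℝ] ℝ).smulRight (mulInvariantVectorField X (f 0)))) (t : ℝ) :
    f t = oneParam X t := by
  have hc : IsMIntegralCurve f (mulInvariantVectorField (I := 𝓡 d) X) := fun t ↦ by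
    have h2 := hasMFDerivAt_mul_left (f t) (hasMFDerivWithinAt_univ.mpr h)
    have h3 := hasMFDerivWithinAt_univ.mp h2
    have e : f = (fun u ↦ f t * f u) ∘ (fun u ↦ u - t) := by
      ext u; simp [← hadd]
    have h4 : HasMFDerivAt 𝓘(ℝ, ℝ) 𝓘(ℝ, ℝ) (fun u : ℝ ↦ u - t) t (.id ℝ ℝ) :=
      ((hasFDerivAt_id t).sub_const t).hasMFDerivAt
    have h3' : HasMFDerivAt 𝓘(ℝ, ℝ) (𝓡 d) (fun u ↦ f t * f u) (t - t)
        ((1 : ℝ →L[ℝ] ℝ).smulRight (mulInvariantVectorField X (f t * f 0))) := by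
      rw [sub_self]; exact h3
    have h5 := HasMFDerivAt.comp (I' := 𝓘(ℝ, ℝ)) (g := fun u ↦ f t * f u) (f := fun u : ℝ ↦ u - t) t h3' h4
    rw [← e] at h5
    have e2 : f t * f 0 = f t := by rw [h1, mul_one]
    rw [e2] at h5
    exact h5
  simpa [h1] using eq_mul_oneParam hc t

/-- The exponential map of a Lie group. -/
noncomputable def lieExp (X : GroupLieAlgebra (𝓡 d) G) : G := oneParam X 1

theorem lieExp_smul (t : ℝ) (X : GroupLieAlgebra (𝓡 d) G) : lieExp (t • X) = oneParam X t := by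
  simp [lieExp, oneParam_smul]

theorem continuous_lieExp_smul (X : GroupLieAlgebra (𝓡 d) G) :
    Continuous fun t : ℝ ↦ lieExp (t • X) := by
  simp only [lieExp_smul]
  exact (oneParam_isMIntegralCurve X).continuous

theorem lieExp_zero : lieExp (0 : GroupLieAlgebra (𝓡 d) G) = 1 := by
  rw [← zero_smul ℝ (0 : GroupLieAlgebra (𝓡 d) G), lieExp_smul, oneParam_zero]

/-- The adjoint action of `G` on its Lie algebra: the derivative at `1` of `x ↦ g x g⁻¹`. -/
noncomputable def Ad (g : G) : GroupLieAlgebra (𝓡 d) G →L[ℝ] GroupLieAlgebra (𝓡 d) G :=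
  mfderiv (𝓡 d) (𝓡 d) (fun x : G ↦ g * x * g⁻¹) 1

theorem lieExp_Ad (g : G) (X : GroupLieAlgebra (𝓡 d) G) :
    lieExp (Ad g X) = g * lieExp X * g⁻¹ := by
  refine (eq_oneParam (f := fun t ↦ g * oneParam X t * g⁻¹) (fun s t ↦ ?_) ?_ ?_ 1).symm
  · rw [oneParam_add]; group
  · simp [oneParam_zero]
  · have h1 : MDifferentiableAt (𝓡 d) (𝓡 d) (fun x : G ↦ g * x * g⁻¹) (oneParam X 0) :=
      (contMDiff_const.mul contMDiff_id |>.mul contMDiff_const :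
        ContMDiff (𝓡 d) (𝓡 d) ∞ (fun x : G ↦ g * x * g⁻¹)).contMDiffAt.mdifferentiableAt (by simp)
    refine (h1.hasMFDerivAt.comp 0 (oneParam_isMIntegralCurve X 0)).congr_mfderiv
      (ContinuousLinearMap.ext fun (c : ℝ) ↦ ?_)
    have e1 : g * oneParam X 0 * g⁻¹ = 1 := by simp [oneParam_zero]
    change mfderiv (𝓡 d) (𝓡 d) (fun x : G ↦ g * x * g⁻¹) (oneParam X 0)
      (c • mulInvariantVectorField X (oneParam X 0)) =
      c • mulInvariantVectorField (Ad g X) (g * oneParam X 0 * g⁻¹)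
    rw [e1, oneParam_zero, mulInvariantVectorField_apply_one, mulInvariantVectorField_apply_one]
    exact map_smul (Ad g) c X

theorem lieExp_add {X Y : GroupLieAlgebra (𝓡 d) G}
    (h : ∀ s t : ℝ, Commute (lieExp (s • X)) (lieExp (t • Y))) :
    lieExp (X + Y) = lieExp X * lieExp Y := by
  simp only [lieExp_smul] at h
  refine (eq_oneParam (f := fun t ↦ oneParam X t * oneParam Y t) (fun s t ↦ ?_) ?_ ?_ 1).symm
  · rw [oneParam_add, oneParam_add, mul_assoc, mul_assoc, ← mul_assoc (oneParam X t),
      (h t s).eq, mul_assoc]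
  · simp [oneParam_zero]
  · have h1 : MDifferentiableAt ((𝓡 d).prod (𝓡 d)) (𝓡 d) (fun p : G × G ↦ p.1 * p.2)
        (oneParam X 0, oneParam Y 0) :=
      (contMDiff_mul (𝓡 d) ∞).contMDiffAt.mdifferentiableAt (by simp)
    refine (HasMFDerivAt.comp 0 h1.hasMFDerivAt ((oneParam_isMIntegralCurve X 0).prodMk
      (oneParam_isMIntegralCurve Y 0))).congr_mfderiv (ContinuousLinearMap.ext fun (c : ℝ) ↦ ?_)
    change mfderiv ((𝓡 d).prod (𝓡 d)) (𝓡 d) (fun p : G × G ↦ p.1 * p.2)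
        (oneParam X 0, oneParam Y 0) (c • mulInvariantVectorField X (oneParam X 0),
          c • mulInvariantVectorField Y (oneParam Y 0)) =
      c • mulInvariantVectorField (X + Y) (oneParam X 0 * oneParam Y 0)
    refine (mfderiv_prod_eq_add_apply h1).trans ?_
    dsimp only
    have e1 : oneParam X 0 * oneParam Y 0 = 1 := by simp [oneParam_zero]
    rw [e1, oneParam_zero, oneParam_zero]
    simp only [mulInvariantVectorField_apply_one]
    refine Eq.trans (congrArg₂ (fun a b : EuclideanSpace ℝ (Fin d) ↦ a + b)
      (mfderiv_one_of_eq_id (fun z : G ↦ z * 1) (by ext; simp) (c • X))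
      (mfderiv_one_of_eq_id (fun z : G ↦ 1 * z) (by ext; simp) (c • Y))) (smul_add c X Y).symm

/-- `expTwoPi X` is the element `e^{2πiτ}` of `G` for `X = iτ` in the Lie algebra. -/
noncomputable def expTwoPi (X : GroupLieAlgebra (𝓡 d) G) : G := lieExp ((2 * Real.pi) • X)

end Exponential

/-! ### Maximal tori, roots and the normalized invariant form -/

section Torus

variable {d : ℕ} {G : Type*} [TopologicalSpace G] [ChartedSpace (EuclideanSpace ℝ (Fin d)) G]
  [Group G]

variable (G) in
/-- A maximal torus of a compact Lie group: a closed connected commutative subgroup which is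
maximal among such subgroups. -/
structure MaximalTorus extends Subgroup G where
  isClosed : IsClosed (toSubgroup : Set G)
  isConnected : IsConnected (toSubgroup : Set G)
  comm : ∀ a ∈ toSubgroup, ∀ b ∈ toSubgroup, a * b = b * a
  maximal : ∀ S : Subgroup G, IsClosed (S : Set G) → IsConnected (S : Set G) →
    (∀ a ∈ S, ∀ b ∈ S, a * b = b * a) → toSubgroup ≤ S → S = toSubgroup

variable [LieGroup (𝓡 d) ∞ G] [T2Space G]

namespace MaximalTorus

variable (d) in
/-- The Cartan algebra `𝔱`, i.e. the Lie algebra of the maximal torus. -/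
noncomputable def cartan (T : MaximalTorus G) : Submodule ℝ (GroupLieAlgebra (𝓡 d) G) where
  carrier := {X | ∀ t : ℝ, lieExp (t • X) ∈ T.toSubgroup}
  zero_mem' t := by
    rw [smul_zero, lieExp_zero]
    exact T.one_mem
  add_mem' {X Y} hX hY t := by
    rw [smul_add, lieExp_add fun a b ↦ ?_]
    · exact T.mul_mem (hX t) (hY t)
    · rw [smul_smul, smul_smul]
      exact T.comm _ (hX _) _ (hY _)
  smul_mem' c X hX t := by
    rw [smul_smul]
    exact hX (t * c)

variable (T : MaximalTorus G)

theorem expTwoPi_smul_mem (X : T.cartan d) (s : ℝ) :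
    expTwoPi (s • (X : GroupLieAlgebra (𝓡 d) G)) ∈ T.toSubgroup := by
  rw [expTwoPi, smul_smul]
  exact X.2 _

variable (d) in
/-- The adjoint action `τ ↦ w τ w⁻¹` of an element `w` of `N(T)` on the Cartan algebra. -/
noncomputable def adjoint (w : Subgroup.normalizer (T.toSubgroup : Set G)) :
    T.cartan d →ₗ[ℝ] T.cartan d :=
  (Ad (d := d) (w : G)).toLinearMap.restrict fun X hX t ↦ by
    change lieExp (t • Ad (d := d) (w : G) X) ∈ T.toSubgroup
    rw [← map_smul, lieExp_Ad]
    exact (Subgroup.mem_normalizer_iff.mp w.2 _).mp (hX t)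

open scoped TensorProduct in
/-- The roots, as real linear functionals on the Cartan algebra: `α ≠ 0` is a root if there is a
root vector `e_α ≠ 0` in the complexified Lie algebra with `[τ, e_α] = α(τ) e_α`. Since
`X = iτ`, this reads `[X, e_α] = i α(X) e_α`. -/
def IsRoot (α : Module.Dual ℝ (T.cartan d)) : Prop :=
  α ≠ 0 ∧ ∃ v : ℂ ⊗[ℝ] GroupLieAlgebra (𝓡 d) G, v ≠ 0 ∧ ∀ X : T.cartan d,
    ⁅(1 : ℂ) ⊗ₜ[ℝ] (X : GroupLieAlgebra (𝓡 d) G), v⁆ = (Complex.I * (α X : ℂ)) • v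

variable (d) in
/-- The square length of the long roots with respect to minus the Killing form. -/
noncomputable def killingLongRootSq : ℝ :=
  sSup {c | ∃ (α : Module.Dual ℝ (T.cartan d)) (X : T.cartan d), T.IsRoot α ∧
    killingForm ℝ (GroupLieAlgebra (𝓡 d) G) X X = -1 ∧ c = α X ^ 2}

variable (d) in
/-- The invariant form `tr` normalized so that long roots have square length `2`. With `X = iτ`
and `Y = iσ`, the value at `X`, `Y` is `tr τσ`, so the form is positive definite. It is the
multiple `-s κ` of the Killing form `κ` for which `|α|²`, computed with `-s κ`, is
`|α|²_{-κ} / s = 2` for the long roots `α`. -/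
noncomputable def trForm : LinearMap.BilinForm ℝ (GroupLieAlgebra (𝓡 d) G) :=
  -(T.killingLongRootSq d / 2) • killingForm ℝ (GroupLieAlgebra (𝓡 d) G)

variable (d) in
/-- A choice of simple roots, given by the dual basis of simple coweights, together with the
coefficients `k_i` of the highest root. -/
structure SimpleRoots (r : ℕ) where
  /-- the simple coweights `λ_i^∨` -/
  coweight : Module.Basis (Fin r) ℝ (T.cartan d)
  /-- the coefficients `k_i` of the highest root -/
  mark : Fin r → ℕ
  isRoot_simple : ∀ i, T.IsRoot (coweight.coord i)
  isRoot_pos_or_neg : ∀ β, T.IsRoot β →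
    (∀ i, ∃ n : ℕ, β (coweight i) = n) ∨ (∀ i, ∃ n : ℕ, β (coweight i) = -n)
  isRoot_highest : T.IsRoot (∑ i, (mark i : ℝ) • coweight.coord i)
  le_highest : ∀ β, T.IsRoot β → ∀ i, β (coweight i) ≤ mark i

end MaximalTorus

end Torus

/-! ### The Weyl alcove, the stabilizers and their universal covers -/

section Alcove

variable {d : ℕ} {G : Type*} [TopologicalSpace G] [ChartedSpace (EuclideanSpace ℝ (Fin d)) G]
  [Group G] [LieGroup (𝓡 d) ∞ G] [T2Space G] {T : MaximalTorus G} {r : ℕ}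

namespace MaximalTorus.SimpleRoots

variable (S : T.SimpleRoots d r)

/-- The simple root `α_i`. -/
noncomputable def simpleRoot (i : Fin r) : Module.Dual ℝ (T.cartan d) := S.coweight.coord i

/-- The highest root `φ = ∑ k_i α_i`. -/
noncomputable def highestRoot : Module.Dual ℝ (T.cartan d) :=
  ∑ i, (S.mark i : ℝ) • S.simpleRoot i

/-- The Weyl alcove. -/
def alcove : Set (T.cartan d) := {τ | (∀ i, 0 ≤ S.simpleRoot i τ) ∧ S.highestRoot τ ≤ 1}

/-- The vertices of the alcove: `τ_0 = 0` and `τ_i = λ_i^∨ / k_i` for `i ≠ 0`. -/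
noncomputable def vertex : Fin (r + 1) → T.cartan d :=
  Fin.cases 0 fun i ↦ (S.mark i : ℝ)⁻¹ • S.coweight i

/-- The open simplex generated by the vertices `τ_i`, `i ∈ I`. -/
def openSimplex (I : Finset (Fin (r + 1))) : Set (T.cartan d) :=
  {τ | ∃ c : Fin (r + 1) → ℝ, (∀ i ∈ I, 0 < c i) ∧ ∑ i ∈ I, c i = 1 ∧
    τ = ∑ i ∈ I, c i • S.vertex i}

/-- The group `G_I`: the adjoint action stabilizer of the elements `e^{2πiτ}` with `τ` in the open
simplex generated by the vertices `τ_i`, `i ∈ I`. -/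
def stab (I : Finset (Fin (r + 1))) : Subgroup G :=
  Subgroup.centralizer ((fun τ : T.cartan d ↦ expTwoPi (τ : GroupLieAlgebra (𝓡 d) G)) ''
    S.openSimplex I)

theorem torus_le_stab (I : Finset (Fin (r + 1))) : T.toSubgroup ≤ S.stab I := by
  rintro g hg _ ⟨τ, -, rfl⟩
  refine T.comm _ ?_ _ hg
  simpa using T.expTwoPi_smul_mem τ 1

end MaximalTorus.SimpleRoots

/-- The universal cover of a (connected) group, realized as the set of homotopy classes, with fixed
endpoints, of paths starting from `1`. -/
def UnivCover (K : Type*) [TopologicalSpace K] [One K] : Type _ :=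
  Σ g : K, Path.Homotopic.Quotient (1 : K) g

/-- The class of a path. -/
def UnivCover.mk {K : Type*} [TopologicalSpace K] [One K] {g : K} (p : Path 1 g) : UnivCover K :=
  ⟨g, Path.Homotopic.Quotient.mk p⟩

/-- The coboundary `(δu)_{z,z',z''} = u_{z',z''} u_{zz',z''}⁻¹ u_{z,z'z''} u_{z,z'}⁻¹`. -/
noncomputable def coboundary {Z : Type*} [Group Z] (u : Z → Z → Circle) (z z' z'' : Z) : Circle :=
  u z' z'' * (u (z * z') z'')⁻¹ * u z (z' * z'') * (u z z')⁻¹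

/-- `γ` is a `C¹` curve on `[0, 1]` with `γ⁻¹ dγ = θ dt`. -/
def HasLogDeriv (γ : ℝ → G) (θ : ℝ → GroupLieAlgebra (𝓡 d) G) : Prop :=
  ContinuousOn θ (Set.Icc 0 1) ∧ ∀ t ∈ Set.Icc (0 : ℝ) 1,
    HasMFDerivWithinAt 𝓘(ℝ, ℝ) (𝓡 d) γ (Set.Icc 0 1) t
      ((1 : ℝ →L[ℝ] ℝ).smulRight (mulInvariantVectorField (θ t) (γ t)))

namespace MaximalTorus.SimpleRoots

variable (S : T.SimpleRoots d r)

/-- The universal cover of `G_I`. -/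
abbrev Cover (I : Finset (Fin (r + 1))) : Type _ := UnivCover (S.stab I)

/-- The path `s ↦ e^{2πisτ}` in `G_I`. -/
noncomputable def expPath (I : Finset (Fin (r + 1))) (τ : T.cartan d) :
    Path (1 : S.stab I) ⟨expTwoPi (τ : GroupLieAlgebra (𝓡 d) G),
      S.torus_le_stab I (by simpa using T.expTwoPi_smul_mem τ 1)⟩ where
  toFun s := ⟨expTwoPi ((s : ℝ) • (τ : GroupLieAlgebra (𝓡 d) G)),
    S.torus_le_stab I (T.expTwoPi_smul_mem τ s)⟩
  continuous_toFun := by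
    refine Continuous.subtype_mk ?_ _
    have h : Continuous fun s : unitInterval ↦
        lieExp ((s : ℝ) • (2 * Real.pi) • (τ : GroupLieAlgebra (𝓡 d) G)) :=
      (continuous_lieExp_smul _).comp continuous_subtype_val
    have e : ∀ s : unitInterval, expTwoPi ((s : ℝ) • (τ : GroupLieAlgebra (𝓡 d) G)) =
        lieExp ((s : ℝ) • (2 * Real.pi) • (τ : GroupLieAlgebra (𝓡 d) G)) := fun s ↦ by
      rw [expTwoPi, smul_comm]
    simpa only [e] using h
  source' := by
    ext
    simp [expTwoPi, lieExp_zero]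
  target' := by
    ext
    simp

/-- The exponential map `τ ↦ e_I^{2πiτ}` from the Cartan algebra to the universal cover of
`G_I`. -/
noncomputable def expCover (I : Finset (Fin (r + 1))) (τ : T.cartan d) : S.Cover I :=
  UnivCover.mk (S.expPath I τ)

/-- The Cartan subgroup of the universal cover of `G_I`. -/
def coverTorus (I : Finset (Fin (r + 1))) : Set (S.Cover I) := Set.range (S.expCover I)

theorem expCover_mem_coverTorus (I : Finset (Fin (r + 1))) (τ : T.cartan d) :
    S.expCover I τ ∈ S.coverTorus I := Set.mem_range_self τ

/-- The formula `χ_i(e_i^{2πiτ}) = e^{2πi tr τ_i τ}` that defines the characters `χ_i` on the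
Cartan subgroups of the universal covers of the groups `G_i`. -/
def IsVertexCharacter (χ : ∀ i, S.coverTorus {i} → Circle) : Prop :=
  ∀ i (τ : T.cartan d), χ i ⟨S.expCover {i} τ, S.expCover_mem_coverTorus {i} τ⟩ =
    Circle.exp (2 * Real.pi * T.trForm d (S.vertex i) τ)

/-- The formula `χ_ij(γ̃) = exp ((1/i) ∫_γ̃ a_ij)`, `a_ij = i tr (τ_j - τ_i)(γ⁻¹ dγ)`, that defines
the functions `χ_ij` on the universal covers of the groups `G_ij`. The integral is taken along any
`C¹` path in the homotopy class `γ̃`. With `γ⁻¹ dγ = iϑ dt`, where `iϑ` is the element `θ` of the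
Lie algebra, the exponent is `i ∫ tr (τ_j - τ_i) ϑ dt`. -/
def IsEdgeCharacter (χ : ∀ i j, S.Cover {i, j} → Circle) : Prop :=
  ∀ i j (g : S.stab {i, j}) (p : Path 1 g) (θ : ℝ → GroupLieAlgebra (𝓡 d) G),
    HasLogDeriv (fun t ↦ (p.extend t : G)) θ →
    χ i j (UnivCover.mk p) =
      Circle.exp (∫ t in (0 : ℝ)..1, T.trForm d (S.vertex j - S.vertex i : T.cartan d) (θ t))

/-- The action of a central subgroup `Z` on the alcove by affine transformations, induced from
the action of `Z` on the conjugacy classes of `G`, together with the elements `w_z` of `N(T)` that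
implement it, and the induced permutation `i ↦ zi` of the vertices. -/
structure CenterAction (Z : Subgroup G) where
  /-- the affine transformation `τ ↦ zτ` -/
  act : Z →* (T.cartan d ≃ᵃ[ℝ] T.cartan d)
  /-- the permutation `i ↦ zi` -/
  perm : Z →* Equiv.Perm (Fin (r + 1))
  /-- the element `w_z` of the normalizer of the torus -/
  w : Z → Subgroup.normalizer (T.toSubgroup : Set G)
  act_alcove : ∀ z, act z '' S.alcove = S.alcove
  act_vertex : ∀ z i, act z (S.vertex i) = S.vertex (perm z i)
  mul_exp : ∀ z : Z, ∀ τ ∈ S.alcove, (z : G) * expTwoPi (τ : GroupLieAlgebra (𝓡 d) G) =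
    (w z : G)⁻¹ * expTwoPi (act z τ : GroupLieAlgebra (𝓡 d) G) * (w z : G)

namespace CenterAction

variable {S} {Z : Subgroup G} (A : S.CenterAction Z)

/-- The discrepancy `c_{z,z'} = w_z w_{z'} w_{zz'}⁻¹`. -/
def c (z z' : Z) : G := (A.w z : G) * (A.w z' : G) * (A.w (z * z') : G)⁻¹

/-- `e_{z,z'}` are elements of the Cartan algebra with `c_{z,z'} = e^{2πi e_{z,z'}}`. -/
def IsLogarithm (e : Z → Z → T.cartan d) : Prop :=
  ∀ z z', A.c z z' = expTwoPi (e z z' : GroupLieAlgebra (𝓡 d) G)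

/-- `(δe)_{z,z',z''} = w_z e_{z',z''} w_z⁻¹ - e_{zz',z''} + e_{z,z'z''} - e_{z,z'}`. -/
noncomputable def deltaE (e : Z → Z → T.cartan d) (z z' z'' : Z) : T.cartan d :=
  T.adjoint d (A.w z) (e z' z'') - e (z * z') z'' + e z (z' * z'') - e z z'

/-- The lift `c̃_{z,z'} = e_I^{2πi e_{z,z'}}` of `c_{z,z'}` to the universal cover of `G_I`. -/
noncomputable def cTilde (_ : S.CenterAction Z) (e : Z → Z → T.cartan d)
    (I : Finset (Fin (r + 1))) (z z' : Z) : S.Cover I :=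
  S.expCover I (e z z')

/-- `(δc̃)_{z,z',z''} = e_I^{2πi (δe)_{z,z',z''}}`, in the Cartan subgroup of the universal cover
of `G_I`. -/
noncomputable def deltaCTilde (e : Z → Z → T.cartan d) (I : Finset (Fin (r + 1)))
    (z z' z'' : Z) : S.coverTorus I :=
  ⟨S.expCover I (A.deltaE e z z' z''), S.expCover_mem_coverTorus I _⟩

/-- `U_{z,z',z''} = χ_{(zz'0)(zz'z''0)}(c̃_{z,z'})^k χ_{zz'z''0}((δc̃)_{z,z',z''})^k`. -/
noncomputable def obstruction (e : Z → Z → T.cartan d) (χ : ∀ i, S.coverTorus {i} → Circle)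
    (χ₂ : ∀ i j, S.Cover {i, j} → Circle) (lev : ℤ) (z z' z'' : Z) : Circle :=
  χ₂ (A.perm (z * z') 0) (A.perm (z * z' * z'') 0) (A.cTilde e _ z z') ^ lev *
    χ (A.perm (z * z' * z'') 0) (A.deltaCTilde e _ z z' z'') ^ lev

/-- The full associativity condition: for all indices `i, j, k, l` and all `z, z', z''`,
`u^{j_z k_z l_z}_{z',z''} (u^{ikl}_{zz',z''})⁻¹ u^{ijl}_{z,z'z''} (u^{ijk}_{z,z'})⁻¹`
is equal to `χ_kl(c̃_{z,z'})^k χ_l((δc̃)_{z,z',z''})^k`. Here `i_z = z⁻¹i`. -/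
def AssociativityCondition (e : Z → Z → T.cartan d) (χ : ∀ i, S.coverTorus {i} → Circle)
    (χ₂ : ∀ i j, S.Cover {i, j} → Circle) (lev : ℤ)
    (v : Fin (r + 1) → Fin (r + 1) → Fin (r + 1) → Z → Z → Circle) : Prop :=
  ∀ i j k l : Fin (r + 1), ∀ z z' z'' : Z,
    v (A.perm z⁻¹ j) (A.perm z⁻¹ k) (A.perm z⁻¹ l) z' z'' * (v i k l (z * z') z'')⁻¹ *
        v i j l z (z' * z'') * (v i j k z z')⁻¹ =
      χ₂ k l (A.cTilde e _ z z') ^ lev * χ l (A.deltaCTilde e _ z z' z'') ^ lev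

end CenterAction

end MaximalTorus.SimpleRoots

end Alcove

end WZW

namespace WZW

/-! The converse is a specialization of the associativity condition: with
$(i,j,k,l)=(0,z0,zz'0,zz'z''0)$ the shifted indices are $j_z=0$, $k_z=z'0$, $l_z=z'z''0$, so all
four factors are values of the reduced family.

For the direct implication, every $\chi$ occurring is evaluated on some $\mathrm e_I^{2\pi i\tau}$
and equals an explicit phase linear in $\tau$. After $\delta u=U$ is used, the claim is a linear
identity between exponents. The only term that does not match at sight is
$\operatorname{tr}(\tau_{z'z''0}-\tau_{z^{-1}l})\,e_{z',z''}$, which has to become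
$\operatorname{tr}(\tau_{zz'z''0}-\tau_l)\,w_ze_{z',z''}w_z^{-1}$, as in $\delta e$. This is
`trForm_vertex_sub`. It rests on two facts: the linear part of $\tau\mapsto z\tau$ is
$\mathrm{Ad}_{w_z}$ (`act_sub_act`), and `trForm`, a multiple of the Killing form, is invariant
because $\mathrm{Ad}_g$ is a Lie algebra automorphism (`Ad_lie`). -/

/-- The target tangent space of `mfderiv` depends on `f x`; fixing the type to the model space lets
the two derivatives be compared. -/
theorem mfderiv_congr_fun {d : ℕ} {M : Type*} [TopologicalSpace M]
    [ChartedSpace (EuclideanSpace ℝ (Fin d)) M] {f f' : M → M} (h : f = f') (x : M) :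
    (mfderiv (𝓡 d) (𝓡 d) f x : EuclideanSpace ℝ (Fin d) →L[ℝ] EuclideanSpace ℝ (Fin d)) =
      mfderiv (𝓡 d) (𝓡 d) f' x := by
  rw [h]

/-! ### The adjoint action by Lie algebra automorphisms, and its compatibility with the exponential
map. -/

section Adjoint

variable {d : ℕ} {G : Type*} [TopologicalSpace G] [ChartedSpace (EuclideanSpace ℝ (Fin d)) G]
  [Group G] [LieGroup (𝓡 d) ∞ G]

theorem contMDiff_conj (g : G) : ContMDiff (𝓡 d) (𝓡 d) ∞ (fun x : G ↦ g * x * g⁻¹) :=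
  (contMDiff_const.mul contMDiff_id).mul contMDiff_const

theorem mdifferentiableAt_conj (g x : G) :
    MDifferentiableAt (𝓡 d) (𝓡 d) (fun x : G ↦ g * x * g⁻¹) x :=
  (contMDiff_conj g).contMDiffAt.mdifferentiableAt (by simp)

theorem mdifferentiableAt_mul_left (g x : G) :
    MDifferentiableAt (𝓡 d) (𝓡 d) (fun x : G ↦ g * x) x :=
  (contMDiff_mul_left (I := 𝓡 d) (n := ∞)).contMDiffAt.mdifferentiableAt (by simp)

theorem mfderiv_conj_comp {g k : G} (hk : k * g = 1) (h : G) :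
    (mfderiv (𝓡 d) (𝓡 d) (fun x : G ↦ k * x * k⁻¹) (g * h * g⁻¹)).comp
      (mfderiv (𝓡 d) (𝓡 d) (fun x : G ↦ g * x * g⁻¹) h) =
    ContinuousLinearMap.id ℝ (EuclideanSpace ℝ (Fin d)) := by
  have e : (fun x : G ↦ k * x * k⁻¹) ∘ (fun x ↦ g * x * g⁻¹) = id := by
    ext x; simp [eq_inv_of_mul_eq_one_left hk, mul_assoc]
  refine (mfderiv_comp (I' := 𝓡 d) h (mdifferentiableAt_conj k (g * h * g⁻¹))
    (mdifferentiableAt_conj g h)).symm.trans ?_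
  rw [e, mfderiv_id]
  rfl

theorem Ad_inv_Ad (g : G) (X : GroupLieAlgebra (𝓡 d) G) : Ad g⁻¹ (Ad g X) = X := by
  have h := mfderiv_conj_comp (d := d) (inv_mul_cancel g) 1
  have e : g * 1 * g⁻¹ = 1 := by simp
  rw [e] at h
  exact DFunLike.congr_fun h X

theorem Ad_Ad_inv (g : G) (X : GroupLieAlgebra (𝓡 d) G) : Ad g (Ad g⁻¹ X) = X := by
  simpa using Ad_inv_Ad g⁻¹ X

/-- Differentiate $g(hx)g^{-1}=(ghg^{-1})(gxg^{-1})$ at $x=1$. -/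
theorem mfderiv_conj_mulInvariantVectorField (g h : G) (X : GroupLieAlgebra (𝓡 d) G) :
    mfderiv (𝓡 d) (𝓡 d) (fun x : G ↦ g * x * g⁻¹) h (mulInvariantVectorField X h) =
      mulInvariantVectorField (Ad g X) (g * h * g⁻¹) := by
  have e : (fun x : G ↦ g * x * g⁻¹) ∘ (fun x ↦ h * x) =
      (fun x ↦ (g * h * g⁻¹) * x) ∘ (fun x ↦ g * x * g⁻¹) := by
    ext x; simp [mul_assoc]
  have h1 := mfderiv_comp (I' := 𝓡 d) (f := fun x ↦ h * x) (1 : G)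
    (mdifferentiableAt_conj (d := d) g (h * 1)) (mdifferentiableAt_mul_left h 1)
  have h2 := mfderiv_comp (I' := 𝓡 d) (f := fun x ↦ g * x * g⁻¹) (1 : G)
    (mdifferentiableAt_mul_left (d := d) (g * h * g⁻¹) (g * 1 * g⁻¹)) (mdifferentiableAt_conj g 1)
  have h3 := DFunLike.congr_fun ((h1.symm.trans (mfderiv_congr_fun e 1)).trans h2) X
  have e1 : h * 1 = h := mul_one h
  have e2 : g * 1 * g⁻¹ = 1 := by simp
  rw [e1, e2] at h3
  exact h3

theorem mpullback_conj_mulInvariantVectorField (g : G) (X : GroupLieAlgebra (𝓡 d) G) :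
    VectorField.mpullback (𝓡 d) (𝓡 d) (fun x : G ↦ g * x * g⁻¹)
      (mulInvariantVectorField (Ad g X)) = mulInvariantVectorField X := by
  ext1 h
  have h1 := mfderiv_conj_comp (d := d) (inv_mul_cancel g) h
  have h2 := mfderiv_conj_comp (d := d) (mul_inv_cancel g) (g * h * g⁻¹)
  have e1 : g⁻¹ * (g * h * g⁻¹) * g⁻¹⁻¹ = h := by group
  rw [e1] at h2
  rw [VectorField.mpullback, ← mfderiv_conj_mulInvariantVectorField]
  rw [ContinuousLinearMap.inverse_eq h2 h1]
  exact DFunLike.congr_fun h1 _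

/-- The bracket is that of left-invariant vector fields, and pullback along conjugation by $g$
commutes with brackets of fields and takes the field of `Ad g X` to that of `X`. -/
theorem Ad_lie (g : G) (X Y : GroupLieAlgebra (𝓡 d) G) : Ad g ⁅X, Y⁆ = ⁅Ad g X, Ad g Y⁆ := by
  have h := VectorField.mpullback_mlieBracket (n := minSmoothness ℝ 3) (I := 𝓡 d) (I' := 𝓡 d)
    (f := fun x : G ↦ g * x * g⁻¹) (x₀ := 1)
    (V := mulInvariantVectorField (Ad g X)) (W := mulInvariantVectorField (Ad g Y))
    (mdifferentiableAt_mulInvariantVectorField _) (mdifferentiableAt_mulInvariantVectorField _)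
    ((contMDiff_conj g).of_le (by
      simp only [minSmoothness_of_isRCLikeNormedField]; exact ENat.LEInfty.out)).contMDiffAt
    (minSmoothness_monotone (by norm_cast))
  -- Writing the bracket as `Ad g` of `Ad g⁻¹` of itself makes its field one that can be pulled
  -- back; evaluation at `1` leaves `Ad g⁻¹ ⁅Ad g X, Ad g Y⁆ = ⁅X, Y⁆`.
  rw [← mulInvariantVector_mlieBracket, mpullback_conj_mulInvariantVectorField,
    mpullback_conj_mulInvariantVectorField, ← GroupLieAlgebra.bracket_def,
    ← GroupLieAlgebra.bracket_def, ← Ad_Ad_inv g ⁅Ad g X, Ad g Y⁆,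
    mpullback_conj_mulInvariantVectorField, mulInvariantVectorField_apply_one] at h
  rw [← h, Ad_Ad_inv]

/-- The adjoint action as an automorphism of the Lie algebra. -/
noncomputable def AdEquiv (g : G) : GroupLieAlgebra (𝓡 d) G ≃ₗ⁅ℝ⁆ GroupLieAlgebra (𝓡 d) G where
  toFun := Ad g
  map_add' := map_add _
  map_smul' := map_smul _
  map_lie' := Ad_lie g _ _
  invFun := Ad g⁻¹
  left_inv := Ad_inv_Ad g
  right_inv := Ad_Ad_inv g

variable [T2Space G]

/-- The two one-parameter subgroups agree near `0`, negative times being reached by inversion, so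
their velocities there coincide. The range $[0,1]$ suits the parameter of a segment in the alcove.
-/
theorem eq_of_lieExp_smul_eq {X Y : GroupLieAlgebra (𝓡 d) G}
    (h : ∀ s ∈ Set.Icc (0 : ℝ) 1, lieExp (s • X) = lieExp (s • Y)) : X = Y := by
  simp only [lieExp_smul] at h
  have hneg (Z : GroupLieAlgebra (𝓡 d) G) (s : ℝ) : oneParam Z s = (oneParam Z (-s))⁻¹ := by
    rw [eq_inv_iff_mul_eq_one, ← oneParam_add, add_neg_cancel, oneParam_zero]
  have hev : oneParam X =ᶠ[nhds 0] oneParam Y := by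
    filter_upwards [Icc_mem_nhds (show (-1 : ℝ) < 0 by norm_num) one_pos] with s hs
    rcases le_total 0 s with h0 | h0
    · exact h s ⟨h0, hs.2⟩
    · rw [hneg X, hneg Y, h (-s) ⟨by linarith, by linarith [hs.1]⟩]
  have hX := oneParam_isMIntegralCurve X 0
  have hY := (oneParam_isMIntegralCurve Y 0).congr_of_eventuallyEq hev
  have hXY := DFunLike.congr_fun (hasMFDerivAt_unique hX hY) (1 : ℝ)
  change (1 : ℝ) • mulInvariantVectorField X (oneParam X 0) =
    (1 : ℝ) • mulInvariantVectorField Y (oneParam Y 0) at hXY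
  rw [oneParam_zero, oneParam_zero, mulInvariantVectorField_apply_one,
    mulInvariantVectorField_apply_one] at hXY
  simpa only [one_smul] using hXY

theorem eq_of_expTwoPi_smul_eq {X Y : GroupLieAlgebra (𝓡 d) G}
    (h : ∀ s ∈ Set.Icc (0 : ℝ) 1, expTwoPi (s • X) = expTwoPi (s • Y)) : X = Y := by
  have h1 : (2 * Real.pi) • X = (2 * Real.pi) • Y := eq_of_lieExp_smul_eq fun s hs ↦ by
    simpa only [expTwoPi, smul_comm s] using h s hs
  exact smul_right_injective _ (by positivity : (2 * Real.pi) ≠ 0) h1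

theorem expTwoPi_Ad (g : G) (X : GroupLieAlgebra (𝓡 d) G) :
    expTwoPi (Ad g X) = g * expTwoPi X * g⁻¹ := by
  rw [expTwoPi, ← map_smul, lieExp_Ad, expTwoPi]

end Adjoint

/-! ### The Cartan algebra, the invariant form, the alcove and the explicit values of $\chi_{ij}$.
-/

namespace MaximalTorus

variable {d r : ℕ} {G : Type*} [TopologicalSpace G] [ChartedSpace (EuclideanSpace ℝ (Fin d)) G]
  [Group G] [LieGroup (𝓡 d) ∞ G] [T2Space G] {T : MaximalTorus G}

theorem expTwoPi_add (τ σ : T.cartan d) :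
    expTwoPi ((τ + σ : T.cartan d) : GroupLieAlgebra (𝓡 d) G) =
      expTwoPi (τ : GroupLieAlgebra (𝓡 d) G) * expTwoPi (σ : GroupLieAlgebra (𝓡 d) G) := by
  simp only [expTwoPi, Submodule.coe_add, smul_add]
  refine lieExp_add fun s t ↦ T.comm _ ?_ _ ?_
  · rw [smul_smul]; exact τ.2 _
  · rw [smul_smul]; exact σ.2 _

theorem trForm_Ad (T : MaximalTorus G) (g : G) (X Y : GroupLieAlgebra (𝓡 d) G) :
    T.trForm d (Ad g X) (Ad g Y) = T.trForm d X Y := by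
  have h : killingForm ℝ (GroupLieAlgebra (𝓡 d) G) (Ad g X) (Ad g Y) = killingForm ℝ _ X Y :=
    LieAlgebra.killingForm_of_equiv_apply (AdEquiv g) X Y
  simp only [trForm, LinearMap.smul_apply, h]

theorem coe_adjoint (w : Subgroup.normalizer (T.toSubgroup : Set G)) (τ : T.cartan d) :
    (T.adjoint d w τ : GroupLieAlgebra (𝓡 d) G) = Ad (w : G) τ := rfl

namespace SimpleRoots

variable (S : T.SimpleRoots d r)

theorem convex_alcove : Convex ℝ S.alcove := by
  have : S.alcove = (⋂ i, {τ | 0 ≤ S.simpleRoot i τ}) ∩ {τ | S.highestRoot τ ≤ 1} := by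
    ext; simp [alcove]
  rw [this]
  exact (convex_iInter fun i ↦ convex_halfSpace_ge (S.simpleRoot i).isLinear _).inter
    (convex_halfSpace_le S.highestRoot.isLinear _)

theorem vertex_mem_alcove (i : Fin (r + 1)) : S.vertex i ∈ S.alcove := by
  refine Fin.cases ⟨fun j ↦ ?_, ?_⟩ (fun i ↦ ⟨fun j ↦ ?_, ?_⟩) i
  · simp [vertex]
  · simp [vertex]
  · simp only [vertex, simpleRoot, Fin.cases_succ, map_smul, smul_eq_mul, Module.Basis.coord_apply,
      Module.Basis.repr_self, Finsupp.single_apply]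
    split_ifs <;> positivity
  · have h : S.highestRoot (S.coweight i) = S.mark i := by
      simp [highestRoot, simpleRoot, LinearMap.sum_apply, Finsupp.single_apply]
    simp only [vertex, Fin.cases_succ, map_smul, smul_eq_mul, h]
    -- This also covers a mark equal to `0`, where the inverse is `0` by convention.
    exact inv_mul_le_one

theorem hasLogDeriv_expPath (I : Finset (Fin (r + 1))) (τ : T.cartan d) :
    HasLogDeriv (fun t ↦ ((S.expPath I τ).extend t : G))
      fun _ ↦ (2 * Real.pi) • (τ : GroupLieAlgebra (𝓡 d) G) := by
  refine ⟨continuousOn_const, fun t ht ↦ ?_⟩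
  -- The extended path is constant outside $[0,1]$, so agreement with the one-parameter subgroup,
  -- and the derivative, are taken within this interval.
  have e : ∀ s ∈ Set.Icc (0 : ℝ) 1, (((S.expPath I τ).extend s : S.stab I) : G) =
      oneParam ((2 * Real.pi) • (τ : GroupLieAlgebra (𝓡 d) G)) s := fun s hs ↦ by
    rw [Path.extend_apply _ hs, ← lieExp_smul, smul_comm]
    rfl
  refine (oneParam_isMIntegralCurve _ t).hasMFDerivWithinAt.congr_mono e (e t ht) subset_rfl
    |>.congr_mfderiv ?_
  have h := e t ht
  dsimp only at h ⊢
  rw [h]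
  rfl

variable {S}

theorem IsEdgeCharacter.apply_expCover {χ : ∀ i j, S.Cover {i, j} → Circle}
    (hχ : S.IsEdgeCharacter χ) (i j : Fin (r + 1)) (τ : T.cartan d) :
    χ i j (S.expCover {i, j} τ) =
      Circle.exp (2 * Real.pi * T.trForm d (S.vertex j - S.vertex i : T.cartan d) τ) := by
  rw [expCover, hχ i j _ _ _ (S.hasLogDeriv_expPath {i, j} τ)]
  simp

/-! ### The affine action of $Z$ and the two implications. -/

namespace CenterAction

variable {Z : Subgroup G} (A : S.CenterAction Z)

/-- The linear part of the affine action of `z` is the adjoint action of `w_z`. -/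
theorem act_sub_act (z : Z) {τ σ : T.cartan d} (hτ : τ ∈ S.alcove) (hσ : σ ∈ S.alcove) :
    A.act z σ - A.act z τ = T.adjoint d (A.w z) (σ - τ) := by
  refine Subtype.ext (eq_of_expTwoPi_smul_eq fun s hs ↦ ?_)
  have hmem : τ + s • (σ - τ) ∈ S.alcove := S.convex_alcove.add_smul_sub_mem hτ hσ hs
  have hact : A.act z (τ + s • (σ - τ)) = A.act z τ + s • (A.act z σ - A.act z τ) := by
    have h := (A.act z).toAffineMap.apply_lineMap τ σ s
    simpa [AffineMap.lineMap_apply, add_comm] using h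
  have h0 := A.mul_exp z τ hτ
  have h1 := A.mul_exp z _ hmem
  -- Dividing the relation at $\tau+s(\sigma-\tau)$ by the one at $\tau$ eliminates the central
  -- element $z$.
  rw [hact, expTwoPi_add, expTwoPi_add, ← mul_assoc, h0] at h1
  rw [coe_adjoint, ← map_smul, expTwoPi_Ad]
  have h2 : expTwoPi ((s • (A.act z σ - A.act z τ) : T.cartan d) : GroupLieAlgebra (𝓡 d) G) =
      A.w z * expTwoPi ((s • (σ - τ) : T.cartan d) : GroupLieAlgebra (𝓡 d) G) * (A.w z : G)⁻¹ := by
    rw [eq_mul_inv_iff_mul_eq]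
    simpa only [mul_assoc, mul_right_inj] using h1.symm
  exact h2

theorem trForm_vertex_sub (z : Z) (i j : Fin (r + 1)) (τ : T.cartan d) :
    T.trForm d (S.vertex i - S.vertex j : T.cartan d) τ =
      T.trForm d (S.vertex (A.perm z i) - S.vertex (A.perm z j) : T.cartan d)
        (T.adjoint d (A.w z) τ) := by
  rw [← A.act_vertex, ← A.act_vertex,
    A.act_sub_act z (S.vertex_mem_alcove j) (S.vertex_mem_alcove i), coe_adjoint, coe_adjoint,
    trForm_Ad]

theorem zpow_neg_mul_coboundary {H : Type*} [CommGroup H] (a b c d u v w x : H) (n : ℤ) :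
    a ^ (-n) * u * (b ^ (-n) * v)⁻¹ * (c ^ (-n) * w) * (d ^ (-n) * x)⁻¹ =
      (a⁻¹ * b * c⁻¹ * d) ^ n * (u * v⁻¹ * w * x⁻¹) := by
  simp only [mul_zpow, inv_zpow, zpow_neg, mul_inv, inv_inv]
  ac_rfl

theorem associativityCondition_of_coboundary_eq {e : Z → Z → T.cartan d}
    {χ : ∀ i, S.coverTorus {i} → Circle} (hχ : S.IsVertexCharacter χ)
    {χ₂ : ∀ i j, S.Cover {i, j} → Circle} (hχ₂ : S.IsEdgeCharacter χ₂) {lev : ℤ}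
    {u : Z → Z → Circle}
    (hu : ∀ z z' z'', coboundary u z z' z'' = A.obstruction e χ χ₂ lev z z' z'') :
    A.AssociativityCondition e χ χ₂ lev fun _ _ k z z' ↦
      χ₂ k (A.perm (z * z') 0) (A.cTilde e _ z z') ^ (-lev) * u z z' := by
  intro i j k l z z' z''
  have hp : A.perm (z * z' * z'') 0 = A.perm z (A.perm (z' * z'') 0) := by
    simp [mul_assoc]
  have hl : l = A.perm z (A.perm z⁻¹ l) := by simp
  -- The factor with indices shifted by $z^{-1}$ is the only one whose vertices are not yet those of
  -- the right-hand side; acting by $z$ corrects them and twists $e_{z',z''}$ by $w_z$.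
  have key := A.trForm_vertex_sub z (A.perm (z' * z'') 0) (A.perm z⁻¹ l) (e z' z'')
  rw [← hl, ← hp] at key
  have hu' := hu z z' z''
  simp only [coboundary, obstruction, cTilde, deltaCTilde, hχ₂.apply_expCover] at hu' ⊢
  rw [hχ] at hu' ⊢
  rw [zpow_neg_mul_coboundary, hu', ← mul_zpow, ← mul_zpow, ← mul_zpow, ← mul_assoc z z' z'']
  simp only [← Circle.exp_neg, ← Circle.exp_add]
  -- Both sides are now the power `lev` of a single phase; the real exponents are compared.
  congr 2
  rw [key]
  simp only [deltaE, map_add, map_sub, Submodule.coe_add, Submodule.coe_sub, LinearMap.sub_apply]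
  ring

theorem coboundary_eq_of_associativityCondition {e : Z → Z → T.cartan d}
    {χ : ∀ i, S.coverTorus {i} → Circle} {χ₂ : ∀ i j, S.Cover {i, j} → Circle} {lev : ℤ}
    {v : Fin (r + 1) → Fin (r + 1) → Fin (r + 1) → Z → Z → Circle}
    (hv : A.AssociativityCondition e χ χ₂ lev v) (z z' z'' : Z) :
    coboundary (fun z z' ↦ v 0 (A.perm z 0) (A.perm (z * z') 0) z z') z z' z'' =
      A.obstruction e χ χ₂ lev z z' z'' := by
  -- Each index is the image of `0` under the next partial product, so removing $z$ on the left
  -- gives the same pattern for $(z',z'')$.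
  have h := hv 0 (A.perm z 0) (A.perm (z * z') 0) (A.perm (z * z' * z'') 0) z z' z''
  simpa [coboundary, obstruction, mul_assoc] using h

end CenterAction

end SimpleRoots

end MaximalTorus

end WZW

theorem lemma3 {d r : ℕ} {G : Type*} [TopologicalSpace G]
    [ChartedSpace (EuclideanSpace ℝ (Fin d)) G] [Group G] [LieGroup (𝓡 d) ∞ G] [T2Space G]
    [CompactSpace G] [SimplyConnectedSpace G] [LieAlgebra.IsSimple ℝ (GroupLieAlgebra (𝓡 d) G)]
    (T : WZW.MaximalTorus G) (S : T.SimpleRoots d r)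
    (Z : Subgroup G) (hZ : Z ≤ Subgroup.center G) (A : S.CenterAction Z)
    (e : Z → Z → T.cartan d) (he : A.IsLogarithm e)
    (χ : ∀ i, S.coverTorus {i} → Circle) (hχ : S.IsVertexCharacter χ)
    (χ₂ : ∀ i j, S.Cover {i, j} → Circle) (hχ₂ : S.IsEdgeCharacter χ₂)
    (lev : ℤ) :
    (∀ u : Z → Z → Circle,
      (∀ z z' z'', WZW.coboundary u z z' z'' =
        A.obstruction e χ χ₂ lev z z' z'') →
      A.AssociativityCondition e χ χ₂ lev fun _ _ k z z' ↦
        χ₂ k (A.perm (z * z') 0) (A.cTilde e _ z z') ^ (-lev) * u z z') ∧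
    (∀ v : Fin (r + 1) → Fin (r + 1) → Fin (r + 1) → Z → Z → Circle,
      A.AssociativityCondition e χ χ₂ lev v →
      ∀ z z' z'', WZW.coboundary
        (fun z z' ↦ v 0 (A.perm z 0) (A.perm (z * z') 0) z z') z z' z'' =
        A.obstruction e χ χ₂ lev z z' z'') := by
  exact ⟨fun u hu ↦ A.associativityCondition_of_coboundary_eq hχ hχ₂ hu,
    fun v hv ↦ A.coboundary_eq_of_associativityCondition hv⟩
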